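/- Let $\Delta\ge 1$ be an integer and let $B_\Delta=\bigl(\frac{\Delta-2}{\Delta},\frac{\Delta}{\Delta-2}\bigr)$ be the correlation-decay interval, where the upper end point is read as $+\infty$ if $\Delta=2$ (and $B_1=\emptyset$). For a finite simple graph $G=(V,E)$ and $\beta\in\mathbb{C}$, the zero-field Ising partition function is $$Z_G(\beta)=\sum_{\sigma:V\to\{+,-\}}\beta^{|\{\{u,v\}\in E\,:\,\sigma(u)\ne\sigma(v)\}|}.$$ If some vertices of $G$ are pinned to $+$ or $-$, the sum is restricted to those $\sigma$ that take the prescribed spin at every pinned vertex. For every real $\beta\in B_\Delta$ there is a $\delta>0$, depending only on $\beta$ and $\Delta$, such that for every $\beta'\in\mathbb{C}$ with $|\beta'-\beta|<\delta$ and every finite simple graph $G$ of maximum degree at most $\Delta$ we have $Z_G(\beta')\ne 0$. Moreover, with the same $\delta$, $Z_G(\beta')\neq 0$ also when an arbitrary set of vertices of $G$ is pinned to arbitrary spins in $\{+,-\}$. -/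

import Mathlib

namespace Ising

/-- The two spins: `true` is the spin `+`, `false` is the spin `-`. -/
abbrev Spin : Type := Bool

/-- The correlation decay region, the open interval with end points `(Δ - 2) / Δ` and
`Δ / (Δ - 2)`. For `Δ = 2` the upper end point `2 / 0` is read as `+∞`. -/
def correlationDecayRegion (Δ : ℕ) : Set ℝ :=
  {β | ((Δ : ℝ) - 2) / (Δ : ℝ) < β ∧ (Δ ≠ 2 → β < (Δ : ℝ) / ((Δ : ℝ) - 2))}

section

variable {V : Type*} [Fintype V] [DecidableEq V] (G : SimpleGraph V) [DecidableRel G.Adj]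

/-- The edges of `G` whose two end points have different spins under `σ`. -/
def cutEdges (σ : V → Spin) : Finset (Sym2 V) :=
  G.edgeFinset.filter (fun e => ¬ (e.map σ).IsDiag)

/-- The weight of the configuration `σ` in the Ising model without external field on `G`,
at interaction parameter `β`. -/
noncomputable def weight (β : ℂ) (σ : V → Spin) : ℂ :=
  β ^ (cutEdges G σ).card

/-- The Ising partition function (without external field) of `G`. -/
noncomputable def partitionFunction (β : ℂ) : ℂ :=
  ∑ σ : V → Spin, weight G β σ

/-- The Ising partition function (without external field) of `G` in which some vertices are pinned:
`v` is pinned to the spin `s` if `τ v = some s`, and not pinned if `τ v = none`. The sum runs over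
the configurations that agree with the pinning. -/
noncomputable def pinnedPartitionFunction (τ : V → Option Spin) (β : ℂ) : ℂ :=
  ∑ σ : V → Spin with ∀ v s, τ v = some s → σ v = s, weight G β σ

end

end Ising

/-! Let R be the ratio of the partition functions with a vertex v set to + and to -. The induction,
on the set of free vertices, shows that R has argument at most d * t, where d counts the neighbours
of v, pinned ones included. Since Δ * t < π, R ≠ -1, so Z = Z₋ (1 + R) ≠ 0. Setting v to + or - adds
a pinned neighbour to each free neighbour of v. Switching these pins from - to + one at a time
writes R as a telescoping product, with a factor b or b⁻¹ for each neighbour already pinned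
(`RatioBound.div_mem_sector`). The factor at u is (z + b) / (b * z + 1), where z is the ratio at u
without that pin. There u has degree at most Δ - 1, so z has argument at most (Δ - 1) * t, and the
Möbius map brings this down to t (`Contracts.div_mem_sector`). This contraction is what β in the
correlation decay interval provides. The pins attached to different neighbours take different spins
midway, so pinned neighbours are recorded as counts p, m per vertex rather than as vertices of a
graph. -/

namespace Ising

/-! ### Sectors around the positive real axis -/

/-- The complex numbers that can be written as `r * exp (θ * I)` with `0 < r` and `|θ| ≤ t`. -/
def sector (t : ℝ) : Set ℂ :=
  {z | ∃ r θ : ℝ, 0 < r ∧ |θ| ≤ t ∧ z = r * Complex.exp (θ * Complex.I)}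

theorem sector_mono {s t : ℝ} (h : s ≤ t) : sector s ⊆ sector t := by
  rintro z ⟨r, θ, hr, hθ, rfl⟩
  exact ⟨r, θ, hr, hθ.trans h, rfl⟩

theorem ne_zero_of_mem_sector {t : ℝ} {z : ℂ} (hz : z ∈ sector t) : z ≠ 0 := by
  obtain ⟨r, θ, hr, -, rfl⟩ := hz
  exact mul_ne_zero (by exact_mod_cast hr.ne') (Complex.exp_ne_zero _)

theorem one_mem_sector {t : ℝ} (ht : 0 ≤ t) : (1 : ℂ) ∈ sector t :=
  ⟨1, 0, one_pos, by simpa using ht, by simp⟩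

/-- Membership asks for some angle, not the principal argument, so half-angles add without
wrap-around. -/
theorem mul_mem_sector {s t : ℝ} {z w : ℂ} (hz : z ∈ sector s) (hw : w ∈ sector t) :
    z * w ∈ sector (s + t) := by
  obtain ⟨r, θ, hr, hθ, rfl⟩ := hz
  obtain ⟨r', θ', hr', hθ', rfl⟩ := hw
  refine ⟨r * r', θ + θ', mul_pos hr hr', (abs_add_le _ _).trans (add_le_add hθ hθ'), ?_⟩
  push_cast
  rw [add_mul, Complex.exp_add]
  ring

theorem inv_mem_sector {t : ℝ} {z : ℂ} (hz : z ∈ sector t) : z⁻¹ ∈ sector t := by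
  obtain ⟨r, θ, hr, hθ, rfl⟩ := hz
  refine ⟨r⁻¹, -θ, inv_pos.2 hr, by rwa [abs_neg], ?_⟩
  push_cast
  rw [mul_inv, ← Complex.exp_neg, neg_mul]

theorem pow_mem_sector {t : ℝ} {z : ℂ} (hz : z ∈ sector t) (n : ℕ) : z ^ n ∈ sector (n * t) := by
  induction n with
  | zero => simpa using one_mem_sector le_rfl
  | succ n ih =>
    rw [pow_succ]
    convert mul_mem_sector ih hz using 2
    push_cast
    ring

theorem mem_sector_of_abs_im_le {t : ℝ} {z : ℂ} (hre : 0 < z.re) (him : |z.im| ≤ t * z.re) :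
    z ∈ sector t := by
  have hz : z ≠ 0 := fun h => by simp [h] at hre
  refine ⟨‖z‖, z.arg, norm_pos_iff.2 hz, ?_, (Complex.norm_mul_exp_arg_mul_I z).symm⟩
  have harg := abs_lt.1 (Complex.abs_arg_lt_pi_div_two_iff.2 (Or.inl hre))
  have htan : Real.tan |z.arg| = |z.im| / z.re := by
    rcases abs_cases z.arg with ⟨h, h'⟩ | ⟨h, h'⟩
    · rw [h, Complex.tan_arg, abs_of_nonneg (Complex.arg_nonneg_iff.1 h')]
    · rw [h, Real.tan_neg, Complex.tan_arg, abs_of_neg (Complex.arg_neg_iff.1 h'), neg_div]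
  calc |z.arg| ≤ Real.tan |z.arg| := Real.le_tan (abs_nonneg _) (abs_lt.2 harg)
    _ ≤ t := by rw [htan]; exact (div_le_iff₀ hre).2 him

theorem one_add_ne_zero_of_mem_sector {t : ℝ} (ht : t < Real.pi) {z : ℂ} (hz : z ∈ sector t) :
    1 + z ≠ 0 := by
  obtain ⟨r, θ, hr, hθ, rfl⟩ := hz
  intro h
  have hre := congrArg Complex.re h
  have him := congrArg Complex.im h
  simp only [Complex.add_re, Complex.add_im, Complex.one_re, Complex.one_im, Complex.re_ofReal_mul,
    Complex.im_ofReal_mul, Complex.exp_ofReal_mul_I_re, Complex.exp_ofReal_mul_I_im,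
    Complex.zero_re, Complex.zero_im, zero_add] at hre him
  have hsin : Real.sin θ = 0 := by
    rcases mul_eq_zero.1 him with h | h
    · exact absurd h hr.ne'
    · exact h
  have hθ' := abs_lt.1 (hθ.trans_lt ht)
  have h0 : θ = 0 := (Real.sin_eq_zero_iff_of_lt_of_lt hθ'.1 hθ'.2).1 hsin
  rw [h0, Real.cos_zero] at hre
  linarith

/-! ### Contraction of the one-edge recursion -/

/-- The conditions on the interaction parameter under which the one-edge recursion contracts the
sector of half-angle `k * t` into the sector of half-angle `t`. -/
structure Contracts (k t : ℝ) (b : ℂ) : Prop where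
  lt_re : t < b.re
  abs_im_lt : |b.im| < t ^ 2
  lt_mul : k * |1 - ‖b‖ ^ 2| < 2 * (b.re - t) + (1 + ‖b‖ ^ 2) * (1 - (k * t) ^ 2 / 2)

theorem Contracts.mem_sector {k t : ℝ} {b : ℂ} (h : Contracts k t b) (ht : 0 < t) :
    b ∈ sector t := by
  refine mem_sector_of_abs_im_le (ht.trans h.lt_re) ?_
  nlinarith [h.abs_im_lt, h.lt_re]

/-- Multiplying by the conjugate of the denominator leaves the argument unchanged, so it suffices to
bound |Im w| by t * Re w for the product w. -/
theorem Contracts.div_mem_sector {k t : ℝ} {b z : ℂ} (h : Contracts k t b) (ht : 0 < t)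
    (hz : z ∈ sector (k * t)) : (z + b) / (b * z + 1) ∈ sector t := by
  obtain ⟨r, θ, hr, hθ, hz⟩ := hz
  have hk : 0 ≤ k * t := (abs_nonneg _).trans hθ
  have hsin : |Real.sin θ| ≤ k * t := Real.abs_sin_le_abs.trans hθ
  have hcos : 1 - (k * t) ^ 2 / 2 ≤ Real.cos θ := by
    have := Real.one_sub_sq_div_two_le_cos (x := θ)
    have h2 : θ ^ 2 ≤ (k * t) ^ 2 := sq_le_sq' (abs_le.1 hθ).1 (abs_le.1 hθ).2
    linarith
  have hzre : z.re = r * Real.cos θ := by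
    rw [hz, Complex.re_ofReal_mul, Complex.exp_ofReal_mul_I_re]
  have hzim : z.im = r * Real.sin θ := by
    rw [hz, Complex.im_ofReal_mul, Complex.exp_ofReal_mul_I_im]
  have hcs := Real.sin_sq_add_cos_sq θ
  set q : ℝ := ‖b‖ ^ 2 with hq
  have hq' : q = b.re ^ 2 + b.im ^ 2 := by
    rw [hq, ← Complex.normSq_eq_norm_sq, Complex.normSq_apply]; ring
  set w : ℂ := (z + b) * (starRingEnd ℂ) (b * z + 1) with hw
  have hwre : w.re = b.re * (1 + r ^ 2) + r * (1 + q) * Real.cos θ := by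
    simp only [hw, map_add, map_mul, map_one, Complex.add_re, Complex.add_im, Complex.mul_re,
      Complex.mul_im, Complex.conj_re, Complex.conj_im, Complex.one_re, Complex.one_im, hzre, hzim,
      hq']
    linear_combination (b.re * r ^ 2) * hcs
  have hwim : w.im = b.im * (1 - r ^ 2) + r * (1 - q) * Real.sin θ := by
    simp only [hw, map_add, map_mul, map_one, Complex.add_re, Complex.add_im, Complex.mul_re,
      Complex.mul_im, Complex.conj_re, Complex.conj_im, Complex.one_re, Complex.one_im, hzre, hzim,
      hq']
    linear_combination (-b.im * r ^ 2) * hcs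
  have hkey : k * |1 - q| * r + t * (1 + r ^ 2) ≤ w.re := by
    rw [hwre]
    have h1 : r * (k * |1 - q|) ≤ r * (2 * (b.re - t) + (1 + q) * (1 - (k * t) ^ 2 / 2)) :=
      mul_le_mul_of_nonneg_left h.lt_mul.le hr.le
    have h2 : r * (1 + q) * (1 - (k * t) ^ 2 / 2) ≤ r * (1 + q) * Real.cos θ :=
      mul_le_mul_of_nonneg_left hcos (by positivity)
    -- This replaces 1 + r² by 2r in the (b.re - t) part; the reserved t * (1 + r²) later absorbs
    -- the error from b.im.
    have h3 : 0 ≤ (b.re - t) * (1 - r) ^ 2 :=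
      mul_nonneg (sub_pos.2 h.lt_re).le (sq_nonneg _)
    nlinarith
  have him : |w.im| ≤ t * w.re := by
    have h1 : |b.im * (1 - r ^ 2)| ≤ t ^ 2 * (1 + r ^ 2) := by
      rw [abs_mul]
      refine mul_le_mul h.abs_im_lt.le ?_ (abs_nonneg _) (sq_nonneg _)
      rw [abs_le]; constructor <;> nlinarith [sq_nonneg r]
    have h2 : |r * (1 - q) * Real.sin θ| ≤ r * |1 - q| * (k * t) := by
      rw [abs_mul, abs_mul, abs_of_pos hr]
      exact mul_le_mul_of_nonneg_left hsin (by positivity)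
    calc |w.im| ≤ t ^ 2 * (1 + r ^ 2) + r * |1 - q| * (k * t) := by
          rw [hwim]; exact (abs_add_le _ _).trans (add_le_add h1 h2)
      _ = t * (k * |1 - q| * r + t * (1 + r ^ 2)) := by ring
      _ ≤ t * w.re := mul_le_mul_of_nonneg_left hkey ht.le
  have hre : 0 < w.re := by
    have hk' : 0 ≤ k := nonneg_of_mul_nonneg_left hk ht
    refine lt_of_lt_of_le ?_ hkey
    positivity
  have hden : b * z + 1 ≠ 0 := by
    intro h0
    rw [hw, h0, map_zero, mul_zero, Complex.zero_re] at hre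
    exact lt_irrefl _ hre
  have heq : (z + b) / (b * z + 1) = (((‖b * z + 1‖ ^ 2)⁻¹ : ℝ) : ℂ) * w := by
    rw [hw, div_eq_mul_inv, Complex.inv_def, Complex.normSq_eq_norm_sq]
    ring
  have hpos : 0 < (‖b * z + 1‖ ^ 2)⁻¹ := inv_pos.2 (pow_pos (norm_pos_iff.2 hden) 2)
  rw [heq]
  refine mem_sector_of_abs_im_le ?_ ?_
  · rw [Complex.re_ofReal_mul]; exact mul_pos hpos hre
  · rw [Complex.re_ofReal_mul, Complex.im_ofReal_mul, abs_mul, abs_of_pos hpos, mul_left_comm]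
    exact mul_le_mul_of_nonneg_left him hpos.le

/-- Dividing by 1 + β leaves (Δ - 1) * |1 - β| < 1 + β; its two sign cases are the two end points.
This is the limit of `Contracts.lt_mul` as t → 0 and b → β. -/
theorem pos_and_mul_abs_lt_of_mem_correlationDecayRegion {Δ : ℕ} (hΔ : 0 < Δ) {β : ℝ}
    (hβ : β ∈ correlationDecayRegion Δ) :
    0 < β ∧ ((Δ : ℝ) - 1) * |1 - β ^ 2| < 2 * β + (1 + β ^ 2) := by
  obtain ⟨h1, h2⟩ := hβ
  have hΔ' : (0 : ℝ) < Δ := by exact_mod_cast hΔ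
  rw [div_lt_iff₀ hΔ'] at h1
  rcases lt_trichotomy Δ 2 with h | rfl | h
  -- Both end points are -1, so the region is empty.
  · obtain rfl : Δ = 1 := by omega
    have := h2 (by norm_num)
    norm_num at this h1
    linarith
  · norm_num at h1 ⊢
    refine ⟨h1, abs_lt.2 ⟨?_, ?_⟩⟩ <;> nlinarith
  · have h3 : (2 : ℝ) < Δ := by exact_mod_cast h
    have h4 := h2 h.ne'
    rw [lt_div_iff₀ (by linarith)] at h4
    have hpos : 0 < β := by
      by_contra hneg
      nlinarith
    refine ⟨hpos, ?_⟩
    rcases abs_cases (1 - β ^ 2) with ⟨h, -⟩ | ⟨h, -⟩ <;> rw [h]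
    · have : 0 < (1 + β) * (β * Δ - (Δ - 2)) := mul_pos (by linarith) (by linarith)
      nlinarith
    · have : 0 < (1 + β) * (Δ - β * (Δ - 2)) := mul_pos (by linarith) (by linarith)
      nlinarith

/-- All conditions are strict and continuous. The angle t is fixed first, since the neighbourhood of
β depends on it through |b.im| < t². -/
theorem exists_contracts {Δ : ℕ} (hΔ : 0 < Δ) {β : ℝ} (hβ : β ∈ correlationDecayRegion Δ) :
    ∃ t : ℝ, 0 < t ∧ Δ * t < Real.pi ∧
      ∀ᶠ b : ℂ in nhds (β : ℂ), Contracts ((Δ : ℝ) - 1) t b := by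
  obtain ⟨hpos, hlt⟩ := pos_and_mul_abs_lt_of_mem_correlationDecayRegion hΔ hβ
  set k : ℝ := (Δ : ℝ) - 1
  have e1 : ∀ᶠ t : ℝ in nhds 0, t < β := eventually_lt_nhds hpos
  have e2 : ∀ᶠ t : ℝ in nhds 0, Δ * t < Real.pi := by
    have : ContinuousAt (fun t : ℝ => (Δ : ℝ) * t) 0 := by fun_prop
    exact this.eventually_lt continuousAt_const (by simpa using Real.pi_pos)
  have e3 : ∀ᶠ t : ℝ in nhds 0,
      k * |1 - β ^ 2| < 2 * (β - t) + (1 + β ^ 2) * (1 - (k * t) ^ 2 / 2) := by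
    refine ContinuousAt.eventually_lt (f := fun _ : ℝ => k * |1 - β ^ 2|)
      (g := fun t : ℝ => 2 * (β - t) + (1 + β ^ 2) * (1 - (k * t) ^ 2 / 2))
      continuousAt_const (by fun_prop) (by simpa using hlt)
  obtain ⟨t, ⟨h1, h2, h3⟩, ht⟩ :=
    (((e1.and (e2.and e3)).filter_mono nhdsWithin_le_nhds).and
      (self_mem_nhdsWithin (s := Set.Ioi (0 : ℝ)))).exists
  have ht : 0 < t := ht
  refine ⟨t, ht, h2, ?_⟩
  have c1 : ∀ᶠ b : ℂ in nhds (β : ℂ), t < b.re :=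
    continuousAt_const.eventually_lt Complex.continuous_re.continuousAt (by simpa using h1)
  have c2 : ∀ᶠ b : ℂ in nhds (β : ℂ), |b.im| < t ^ 2 :=
    Complex.continuous_im.abs.continuousAt.eventually_lt continuousAt_const
      (by simpa using pow_pos ht 2)
  have c3 : ∀ᶠ b : ℂ in nhds (β : ℂ),
      k * |1 - ‖b‖ ^ 2| < 2 * (b.re - t) + (1 + ‖b‖ ^ 2) * (1 - (k * t) ^ 2 / 2) := by
    refine ContinuousAt.eventually_lt (f := fun b : ℂ => k * |1 - ‖b‖ ^ 2|)
      (g := fun b : ℂ => 2 * (b.re - t) + (1 + ‖b‖ ^ 2) * (1 - (k * t) ^ 2 / 2))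
      (Continuous.continuousAt (by fun_prop))
      (Continuous.continuousAt (by have := Complex.continuous_re; fun_prop)) (by simpa using h3)
  filter_upwards [c1, c2, c3] with b h1 h2 h3 using ⟨h1, h2, h3⟩

/-! ### Counting cut edges and degrees -/

section

variable {V : Type*} (G : SimpleGraph V) [DecidableRel G.Adj]

/-- The adjacency indicator. -/
def adjInd (x y : V) : ℕ := if G.Adj x y then 1 else 0

theorem adjInd_comm (x y : V) : adjInd G x y = adjInd G y x := by
  simp only [adjInd, G.adj_comm]

theorem adjInd_self (x : V) : adjInd G x x = 0 := by simp [adjInd]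

/-- The degree of `x` towards `U`, the neighbours pinned outside of `U` included. -/
def load (U : Finset V) (p m : V → ℕ) (x : V) : ℕ := ∑ y ∈ U, adjInd G x y + p x + m x

variable {G} in
-- Each cut edge has a unique orientation from + to -.
theorem card_cutEdges [Fintype V] (σ : V → Spin) :
    (cutEdges G σ).card = ∑ x with σ x = true, ∑ y with σ y = false, adjInd G x y := by
  have : ∑ x with σ x = true, ∑ y with σ y = false, adjInd G x y =
      ((Finset.univ.filter fun x => σ x = true) ×ˢ (Finset.univ.filter fun y => σ y = false)
        |>.filter fun e => G.Adj e.1 e.2).card := by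
    rw [Finset.card_filter, Finset.sum_product]
    rfl
  rw [this]
  symm
  refine Finset.card_bij (fun e _ => s(e.1, e.2)) ?_ ?_ ?_
  · rintro ⟨x, y⟩ h
    simp only [Finset.mem_filter, Finset.mem_product, Finset.mem_univ, true_and] at h
    simp [cutEdges, h.1.1, h.1.2, h.2]
  · rintro ⟨x, y⟩ h ⟨x', y'⟩ h' he
    simp only [Finset.mem_filter, Finset.mem_product, Finset.mem_univ, true_and] at h h'
    rcases Sym2.eq_iff.1 he with ⟨h1, h2⟩ | ⟨h1, h2⟩
    · simp only at h1 h2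
      rw [h1, h2]
    · simp only at h1 h2
      rw [h1, h'.1.2] at h
      simp at h
  · intro e
    induction e using Sym2.ind with
    | _ x y =>
      intro h
      simp only [cutEdges, Finset.mem_filter, SimpleGraph.mem_edgeFinset,
        SimpleGraph.mem_edgeSet, Sym2.map_mk, Sym2.mk_isDiag_iff] at h
      cases hx : σ x <;> cases hy : σ y
      · simp [hx, hy] at h
      · exact ⟨(y, x), by simp [hx, hy, h.1.symm], Sym2.eq_swap⟩
      · exact ⟨(x, y), by simp [hx, hy, h.1], rfl⟩
      · simp [hx, hy] at h

variable {G} in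
theorem load_pinned [Fintype V] (τ : V → Option Spin) (x : V) :
    load G (Finset.univ.filter fun x => τ x = none)
      (fun y => ∑ x with τ x = some true, adjInd G y x)
      (fun x => ∑ y with τ y = some false, adjInd G x y) x = G.degree x := by
  have hdeg : G.degree x = ∑ y, adjInd G x y := by
    rw [← SimpleGraph.card_neighborFinset_eq_degree, SimpleGraph.neighborFinset_eq_filter,
      Finset.card_filter]
    rfl
  rw [hdeg, load]
  simp only [Finset.sum_filter, ← Finset.sum_add_distrib]
  refine Finset.sum_congr rfl fun y _ => ?_
  rcases τ y with _ | _ | _ <;> simp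

variable [DecidableEq V]

/-! ### Partition functions with pinned-neighbour counts -/

/-- The indicator function of a finite set. -/
def setInd (N : Finset V) (x : V) : ℕ := if x ∈ N then 1 else 0

/-- The number of cut edges of the configuration on `U` that is `+` on `s` and `-` on `U \ s`, when
every vertex `x` has `p x` further neighbours pinned to `+` and `m x` pinned to `-`. -/
def fieldEnergy (U : Finset V) (p m : V → ℕ) (s : Finset V) : ℕ :=
  ∑ x ∈ s, (m x + ∑ y ∈ U \ s, adjInd G x y) + ∑ y ∈ U \ s, p y

/-- The Ising partition function of the graph induced on `U`, when every vertex `x` has `p x`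
further neighbours pinned to `+` and `m x` pinned to `-`. -/
noncomputable def fieldPartition (b : ℂ) (U : Finset V) (p m : V → ℕ) : ℂ :=
  ∑ s ∈ U.powerset, b ^ fieldEnergy G U p m s

variable {G}

theorem fieldPartition_empty (b : ℂ) (p m : V → ℕ) : fieldPartition G b ∅ p m = 1 := by
  simp [fieldPartition, fieldEnergy]

theorem fieldPartition_congr (b : ℂ) {U : Finset V} {p m p' m' : V → ℕ}
    (hp : ∀ x ∈ U, p x = p' x) (hm : ∀ x ∈ U, m x = m' x) :
    fieldPartition G b U p m = fieldPartition G b U p' m' := by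
  refine Finset.sum_congr rfl fun s hs => ?_
  have hs := Finset.mem_powerset.1 hs
  congr 1
  unfold fieldEnergy
  congr 1
  · exact Finset.sum_congr rfl fun x hx => by rw [hm x (hs hx)]
  · exact Finset.sum_congr rfl fun x hx => hp x (Finset.mem_sdiff.1 hx).1

theorem fieldPartition_insert (b : ℂ) {v : V} {W : Finset V} (hv : v ∉ W) (p m : V → ℕ) :
    fieldPartition G b (insert v W) p m =
      b ^ m v * fieldPartition G b W (p + adjInd G v) m +
        b ^ p v * fieldPartition G b W p (m + adjInd G v) := by
  unfold fieldPartition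
  rw [Finset.sum_powerset_insert hv, add_comm, Finset.mul_sum, Finset.mul_sum]
  congr 1 <;> refine Finset.sum_congr rfl fun s hs => ?_ <;>
    have hs := Finset.mem_powerset.1 hs <;> have hvs : v ∉ s := fun h => hv (hs h) <;>
    rw [← pow_add] <;> congr 1
  · have h1 : insert v W \ insert v s = W \ s := by
      ext x; by_cases hx : x = v <;> simp_all
    simp only [fieldEnergy, h1, Finset.sum_insert hvs, Pi.add_apply, Finset.sum_add_distrib]
    ring
  · have h1 : insert v W \ s = insert v (W \ s) := Finset.insert_sdiff_of_notMem _ hvs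
    have h2 : v ∉ W \ s := fun h => hv (Finset.mem_sdiff.1 h).1
    simp only [fieldEnergy, h1, Finset.sum_insert h2, Pi.add_apply, Finset.sum_add_distrib,
      adjInd_comm G _ v]
    ring

theorem fieldPartition_insert_add_left (b : ℂ) {u : V} {W : Finset V} (hu : u ∉ W) (p m : V → ℕ) :
    fieldPartition G b (insert u W) (p + setInd {u}) m =
      b ^ m u * fieldPartition G b W (p + adjInd G u) m +
        b * (b ^ p u * fieldPartition G b W p (m + adjInd G u)) := by
  have h0 : ∀ x ∈ W, setInd {u} x = 0 := fun x hx => by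
    simp [setInd, ne_of_mem_of_not_mem hx hu]
  rw [fieldPartition_insert b hu]
  congr 1
  · congr 1
    exact fieldPartition_congr b (fun x hx => by simp [h0 x hx]) fun _ _ => rfl
  · rw [fieldPartition_congr b (p := p + setInd {u}) (p' := p) (fun x hx => by simp [h0 x hx])
      fun _ _ => rfl]
    simp only [Pi.add_apply, setInd, Finset.mem_singleton, if_true, pow_succ]
    ring

theorem fieldPartition_insert_add_right (b : ℂ) {u : V} {W : Finset V} (hu : u ∉ W)
    (p m : V → ℕ) :
    fieldPartition G b (insert u W) p (m + setInd {u}) =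
      b * (b ^ m u * fieldPartition G b W (p + adjInd G u) m) +
        b ^ p u * fieldPartition G b W p (m + adjInd G u) := by
  have h0 : ∀ x ∈ W, setInd {u} x = 0 := fun x hx => by
    simp [setInd, ne_of_mem_of_not_mem hx hu]
  rw [fieldPartition_insert b hu]
  congr 1
  · rw [fieldPartition_congr b (m := m + setInd {u}) (m' := m) (fun _ _ => rfl)
      fun x hx => by simp [h0 x hx]]
    simp only [Pi.add_apply, setInd, Finset.mem_singleton, if_true, pow_succ]
    ring
  · congr 1
    exact fieldPartition_congr b (fun _ _ => rfl) fun x hx => by simp [h0 x hx]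

/-! ### The induction on ratios -/

variable (G) in
/-- On `U`, whatever the fields of total degree at most `Δ`, the partition function does not vanish,
and the ratio at a vertex of degree less than `Δ` lies in the sector of half-angle `(Δ - 1) * t`. -/
def RatioBound (Δ : ℕ) (t : ℝ) (b : ℂ) (U : Finset V) : Prop :=
  ∀ p m : V → ℕ, (∀ x ∈ U, load G U p m x ≤ Δ) →
    fieldPartition G b U p m ≠ 0 ∧
      ∀ v W, v ∉ W → insert v W = U → load G U p m v < Δ →
        b ^ m v * fieldPartition G b W (p + adjInd G v) m /
          (b ^ p v * fieldPartition G b W p (m + adjInd G v)) ∈ sector (((Δ : ℝ) - 1) * t)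

/-- Telescoping: each vertex of N switches its extra pin separately, at a cost of angle t. -/
theorem RatioBound.div_mem_sector {Δ : ℕ} {t : ℝ} {b : ℂ} {W : Finset V} (h : RatioBound G Δ t b W)
    (ht : 0 < t) (hb : Contracts ((Δ : ℝ) - 1) t b) (N : Finset V) :
    ∀ p m : V → ℕ, N ⊆ W → (∀ x ∈ W, load G W p m x + setInd N x ≤ Δ) →
      fieldPartition G b W (p + setInd N) m / fieldPartition G b W p (m + setInd N) ∈
        sector (N.card * t) := by
  induction N using Finset.induction_on with
  | empty =>
    intro p m _ hload
    have h0 : setInd (∅ : Finset V) = 0 := by ext x; simp [setInd]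
    rw [h0, add_zero, add_zero, div_self (h p m fun x hx => by simpa [h0] using hload x hx).1]
    simpa using one_mem_sector le_rfl
  | insert u N hu ih =>
    intro p m hN hload
    have hins : setInd (insert u N) = setInd {u} + setInd N := by
      ext x
      by_cases hx : x = u
      · subst hx; simp [setInd, hu]
      · simp [setInd, hx]
    rw [hins] at hload ⊢
    have huW : u ∈ W := hN (Finset.mem_insert_self u N)
    have hfirst := ih (p + setInd {u}) m ((Finset.subset_insert u N).trans hN) fun x hx => by
      have := hload x hx
      simp only [load, Pi.add_apply] at this ⊢
      omega
    have hload' : ∀ x ∈ W, load G W p (m + setInd N) x + setInd {u} x ≤ Δ := fun x hx => by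
      have := hload x hx
      simp only [load, Pi.add_apply] at this ⊢
      omega
    -- Without its extra pin u has load below Δ, so its ratio A / B lies in the sector that the
    -- Möbius map contracts.
    have hsecond : fieldPartition G b W (p + setInd {u}) (m + setInd N) /
        fieldPartition G b W p (m + setInd N + setInd {u}) ∈ sector t := by
      have hr := (h p (m + setInd N) fun x hx => by have := hload' x hx; omega).2 u (W.erase u)
        (Finset.notMem_erase u W) (Finset.insert_erase huW) (by
          have := hload' u huW
          simp only [setInd, Finset.mem_singleton, if_true] at this ⊢
          omega)
      have hr0 := ne_zero_of_mem_sector hr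
      have hmem := hb.div_mem_sector ht hr
      have e1 := fieldPartition_insert_add_left (G := G) b (Finset.notMem_erase u W) p
        (m + setInd N)
      have e2 := fieldPartition_insert_add_right (G := G) b (Finset.notMem_erase u W) p
        (m + setInd N)
      rw [Finset.insert_erase huW] at e1 e2
      rw [e1, e2]
      have hB := (div_ne_zero_iff.1 hr0).2
      generalize b ^ p u * fieldPartition G b (W.erase u) p (m + setInd N + adjInd G u) = B
        at hmem hB ⊢
      generalize b ^ (m + setInd N) u * fieldPartition G b (W.erase u) (p + adjInd G u)
        (m + setInd N) = A at hmem ⊢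
      convert hmem using 1
      rw [← mul_div_mul_right (A / B + b) _ hB, add_mul, add_mul, mul_assoc b,
        div_mul_cancel₀ A hB, one_mul]
    have hmid : fieldPartition G b W (p + setInd {u}) (m + setInd N) ≠ 0 :=
      (h _ _ fun x hx => by
        have := hload' x hx
        simp only [load, Pi.add_apply] at this ⊢
        omega).1
    have hprod := mul_mem_sector hfirst hsecond
    rw [div_mul_div_cancel₀ hmid] at hprod
    rw [Finset.card_insert_of_notMem hu, ← add_assoc, add_comm (setInd {u}) (setInd N),
      ← add_assoc]
    convert hprod using 2
    push_cast
    ring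

theorem ratioBound {Δ : ℕ} {t : ℝ} {b : ℂ} (ht : 0 < t) (htΔ : Δ * t < Real.pi)
    (hb : Contracts ((Δ : ℝ) - 1) t b) (U : Finset V) : RatioBound G Δ t b U := by
  have hsec := hb.mem_sector ht
  have hb0 : b ≠ 0 := ne_zero_of_mem_sector hsec
  induction U using Finset.strongInduction with
  | H U ih =>
    intro p m hload
    have key : ∀ v W, v ∉ W → insert v W = U →
        b ^ p v * fieldPartition G b W p (m + adjInd G v) ≠ 0 ∧
        b ^ m v * fieldPartition G b W (p + adjInd G v) m /
          (b ^ p v * fieldPartition G b W p (m + adjInd G v)) ∈ sector (load G U p m v * t) := by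
      rintro v W hv rfl
      have hW := ih W (Finset.ssubset_insert hv)
      have hind : ∀ x ∈ W, adjInd G v x = setInd (W.filter (G.Adj v)) x := fun x hx => by
        simp [adjInd, setInd, hx]
      -- Removing v turns an edge to v into a pinned neighbour, so loads do not grow.
      have hloadW : ∀ x ∈ W, load G W p m x + adjInd G v x ≤ Δ := fun x hx => by
        have := hload x (Finset.mem_insert_of_mem hx)
        rw [load, Finset.sum_insert hv, adjInd_comm G x v] at this
        rw [load]
        omega
      have hminus : fieldPartition G b W p (m + adjInd G v) ≠ 0 :=
        (hW _ _ fun x hx => by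
          have := hloadW x hx
          simp only [load, Pi.add_apply] at this ⊢
          omega).1
      refine ⟨mul_ne_zero (pow_ne_zero _ hb0) hminus, ?_⟩
      have hdiv := hW.div_mem_sector ht hb (W.filter (G.Adj v)) p m (Finset.filter_subset _ _)
        fun x hx => by rw [← hind x hx]; exact hloadW x hx
      rw [fieldPartition_congr b (p' := p + adjInd G v) (m' := m)
          (fun x hx => by rw [Pi.add_apply, Pi.add_apply, hind x hx]) (fun _ _ => rfl),
        fieldPartition_congr b (m := m + setInd _) (p' := p) (m' := m + adjInd G v)
          (fun _ _ => rfl) (fun x hx => by rw [Pi.add_apply, Pi.add_apply, hind x hx])] at hdiv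
      have hprod := mul_mem_sector (mul_mem_sector (pow_mem_sector hsec (m v))
        (inv_mem_sector (pow_mem_sector hsec (p v)))) hdiv
      have hcard : ∑ y ∈ insert v W, adjInd G v y = (W.filter (G.Adj v)).card := by
        rw [Finset.sum_insert hv, adjInd_self, zero_add, Finset.card_filter]
        rfl
      convert hprod using 1
      · rw [load, hcard]
        congr 1
        push_cast
        ring
      · rw [div_eq_mul_inv, div_eq_mul_inv, mul_inv]
        ring
    refine ⟨?_, fun v W hv hU hlt => sector_mono ?_ (key v W hv hU).2⟩
    · rcases U.eq_empty_or_nonempty with rfl | ⟨v, hv⟩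
      · rw [fieldPartition_empty]
        exact one_ne_zero
      · obtain ⟨hne, hmem⟩ := key v (U.erase v) (Finset.notMem_erase v U) (Finset.insert_erase hv)
        have hlt : (load G U p m v : ℝ) * t < Real.pi :=
          lt_of_le_of_lt (mul_le_mul_of_nonneg_right (by exact_mod_cast hload v hv) ht.le) htΔ
        have h1 := one_add_ne_zero_of_mem_sector hlt hmem
        have hexp := fieldPartition_insert (G := G) b (Finset.notMem_erase v U) p m
        rw [Finset.insert_erase hv] at hexp
        rw [hexp]
        intro h0
        apply h1
        rw [one_add_div hne, add_comm, h0, zero_div]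
    · refine mul_le_mul_of_nonneg_right ?_ ht.le
      have : (load G U p m v : ℝ) + 1 ≤ Δ := by exact_mod_cast hlt
      linarith

/-! ### Back to pinned partition functions -/

variable [Fintype V]

/-- A configuration is determined by its set of free + vertices; the prefactor counts edges between
oppositely pinned vertices. -/
theorem pinnedPartitionFunction_eq (τ : V → Option Spin) (b : ℂ) :
    pinnedPartitionFunction G τ b =
      b ^ (∑ x with τ x = some true, ∑ y with τ y = some false, adjInd G x y) *
        fieldPartition G b (Finset.univ.filter fun x => τ x = none)
          (fun y => ∑ x with τ x = some true, adjInd G y x)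
          (fun x => ∑ y with τ y = some false, adjInd G x y) := by
  set U := Finset.univ.filter fun x => τ x = none with hU
  set P := Finset.univ.filter fun x => τ x = some true with hP
  set M := Finset.univ.filter fun x => τ x = some false with hM
  rw [pinnedPartitionFunction, fieldPartition, Finset.mul_sum]
  refine Finset.sum_bij' (fun σ _ => U.filter fun x => σ x = true)
    (fun s _ x => (τ x).getD (decide (x ∈ s))) ?_ ?_ ?_ ?_ ?_
  · intro σ _
    simp
  · intro s _
    simp only [Finset.mem_filter, Finset.mem_univ, true_and]
    intro v a hv
    simp [hv]
  · intro σ hσ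
    simp only [Finset.mem_filter, Finset.mem_univ, true_and] at hσ
    ext x
    cases hx : τ x with
    | none => simp [hU, hx]
    | some a => simp [hσ x a hx]
  · intro s hs
    have hs := Finset.mem_powerset.1 hs
    ext x
    by_cases hx : x ∈ U
    · have : τ x = none := by simpa [hU] using hx
      simp [hx, this]
    · have : x ∉ s := fun h => hx (hs h)
      simp [hx, this]
  · intro σ hσ
    simp only [Finset.mem_filter, Finset.mem_univ, true_and] at hσ
    rw [weight, ← pow_add, card_cutEdges]
    congr 1
    set s := U.filter fun x => σ x = true with hs
    have hplus : (Finset.univ.filter fun x => σ x = true) = P ∪ s := by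
      ext x
      cases hx : τ x with
      | none => simp [hP, hs, hU, hx]
      | some a => simp [hP, hs, hU, hx, hσ x a hx]
    have hminus : (Finset.univ.filter fun x => σ x = false) = M ∪ (U \ s) := by
      ext x
      cases hx : τ x with
      | none => simp [hM, hs, hU, hx]
      | some a => simp [hM, hs, hU, hx, hσ x a hx]
    have hdP : Disjoint P s := Finset.disjoint_left.2 fun x h h' => by
      simp [hP, hs, hU] at h h'
      simp [h] at h'
    have hdM : Disjoint M (U \ s) := Finset.disjoint_left.2 fun x h h' => by
      simp [hM, hs, hU] at h h'
      simp [h] at h'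
    have hswap : ∑ y ∈ U \ s, ∑ x ∈ P, adjInd G y x = ∑ x ∈ P, ∑ y ∈ U \ s, adjInd G x y := by
      rw [Finset.sum_comm]
      exact Finset.sum_congr rfl fun x _ => Finset.sum_congr rfl fun y _ => adjInd_comm G y x
    rw [hplus, hminus, Finset.sum_union hdP]
    simp only [Finset.sum_union hdM, Finset.sum_add_distrib, fieldEnergy, hswap]
    ring

theorem pinnedPartitionFunction_ne_zero {Δ : ℕ} {t : ℝ} {b : ℂ} (ht : 0 < t)
    (htΔ : Δ * t < Real.pi) (hb : Contracts ((Δ : ℝ) - 1) t b) (hG : G.maxDegree ≤ Δ)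
    (τ : V → Option Spin) : pinnedPartitionFunction G τ b ≠ 0 := by
  rw [pinnedPartitionFunction_eq]
  refine mul_ne_zero (pow_ne_zero _ (ne_zero_of_mem_sector (hb.mem_sector ht)))
    (ratioBound ht htΔ hb _ _ _ fun x _ => ?_).1
  rw [load_pinned]
  exact (G.degree_le_maxDegree x).trans hG

theorem pinnedPartitionFunction_none (b : ℂ) :
    pinnedPartitionFunction G (fun _ => none) b = partitionFunction G b := by
  simp [pinnedPartitionFunction, partitionFunction]

end

end Ising

theorem theorem1 (Δ : ℕ) (hΔ : 0 < Δ) (β : ℝ) (hβ : β ∈ Ising.correlationDecayRegion Δ) :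
    ∃ δ : ℝ, 0 < δ ∧ ∀ β' : ℂ, ‖β' - (β : ℂ)‖ < δ →
      ∀ (V : Type*) [Fintype V] [DecidableEq V] (G : SimpleGraph V) [DecidableRel G.Adj],
        G.maxDegree ≤ Δ →
          Ising.partitionFunction G β' ≠ 0 ∧
            ∀ τ : V → Option Ising.Spin, Ising.pinnedPartitionFunction G τ β' ≠ 0 := by
  obtain ⟨t, ht, htΔ, hev⟩ := Ising.exists_contracts hΔ hβ
  obtain ⟨δ, hδ, hball⟩ := Metric.eventually_nhds_iff.1 hev
  refine ⟨δ, hδ, fun β' hβ' V _ _ G _ hG => ?_⟩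
  have hb := hball (by rwa [dist_eq_norm])
  refine ⟨?_, Ising.pinnedPartitionFunction_ne_zero ht htΔ hb hG⟩
  rw [← Ising.pinnedPartitionFunction_none]
  exact Ising.pinnedPartitionFunction_ne_zero ht htΔ hb hG _
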